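/- Let $(\mathcal H,[\cdot,\cdot])$ be a Krein space with canonical symmetry $J$ and Hilbert scalar product $\langle x,y\rangle=[x,Jy]$, let $T$ be a closed dissipative operator in $\mathcal H$ (i.e. $\operatorname{Im}[x,Tx]\ge 0$ for $x\in\mathcal D_T$; $T$ need not be densely defined), identified with its graph, and let $\mathcal H'$ be a Hilbert space. Inner products are conjugate-linear in the first factor. On $\mathcal H\oplus\mathcal H$ and $\mathcal H'\oplus\mathcal H'$ put $$[(x,x'),(y,y')]_\Gamma=-i([x,y']-[x',y]),\qquad [(u,u'),(v,v')]'_\Gamma=-i(\langle u,v'\rangle'-\langle u',v\rangle').$$ Let $\gamma_T[x,y]=-i([x,Ty]-[Tx,y])$ on $\mathcal D_T$, let $S=T\restriction\{x\in\mathcal D_T:\gamma_T[x,x]=0\}$ be the symmetric part of $T$, let $N$ be the restriction of $T$ to the orthogonal complement of $\mathcal D_S$ in $\mathcal D_T$ with respect to $\langle x,y\rangle_T=\langle x,y\rangle+\langle Tx,Ty\rangle$, and let $\gamma_N=\gamma_T$ on $\mathcal D_N$. Call $\Gamma_0,\Gamma_1$ *boundary maps* of $T$ if they are bounded operators from (the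 graph of) $T$ to $\mathcal H'$ satisfying the Green identity $$[x,y']-[x',y]=\langle\Gamma_0\hat x,\Gamma_1\hat y\rangle'-\langle\Gamma_1\hat x,\Gamma_0\hat y\rangle'\qquad(\hat x=(x,x'),\ \hat y=(y,y')\in T),$$ and such that $\binom{\Gamma_0}{\Gamma_1}$ vanishes on $S$ and has closed range in $\mathcal H'\oplus\mathcal H'$. Write $\mathcal R_{\Gamma_1}$ for the range of $\Gamma_1$, $S_1=\operatorname{Ker}\Gamma_1$, $N_1$ for the restriction of $T$ to the $\langle\cdot,\cdot\rangle_T$-orthogonal complement of $\mathcal D_{S_1}$ in $\mathcal D_T$, and $\Theta_{01}=(\Gamma_0|N_1)(\Gamma_1|N_1)^{-1}$, an operator in $\mathcal H'$ with adjoint relation $\Theta_{01}^*$. **(1)** For any boundary maps $\Gamma_0,\Gamma_1$ of $T$ the following are equivalent: - (a) the range of $\binom{\Gamma_0}{\Gamma_1}$ is complete in the norm $([\hat u,\hat u]'_\Gamma)^{1/2}$; - (a') $\mathcal D_N$ is complete in the norm $\gamma_N[x,x]^{1/2}$; - (b) $\|[(\Gamma_1-i\Gamma_0)|N]\,[(\Gamma_1+i\Gamma_0)|N]^{-1}\|<1$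 (operator norm); - (c) $\mathcal R_{\Gamma_1}+\bigl(\mathcal D_{\Theta_{01}^*}\cap(\Gamma_0(S_1))^\perp\bigr)=\mathcal H'=(\Theta_{01}^*-\Theta_{01})\bigl((\Gamma_0(S_1))^\perp\bigr)+\Gamma_0(S_1)$, where the relation $\Theta_{01}^*-\Theta_{01}$ acts on $\mathcal D_{\Theta_{01}}\cap\mathcal D_{\Theta_{01}^*}\cap(\Gamma_0(S_1))^\perp$. **(2)** Let $\Gamma$ be a unitary relation from $(\mathcal H\oplus\mathcal H,[\cdot,\cdot]_\Gamma)$ to $(\mathcal H'\oplus\mathcal H',[\cdot,\cdot]'_\Gamma)$ (its inverse equals its adjoint with respect to these metrics) whose domain is $S^c$, the $[\cdot,\cdot]_\Gamma$-orthogonal complement of $S$; that is, $(\mathcal H',\Gamma)$ is a unitary boundary pair for $S^c$ with closed domain. Let the operator part $\Gamma_s$ of $\Gamma$ consist of the pairs $(\hat x,\hat u)\in\Gamma$ with $\hat u$ orthogonal, in the Hilbert space $\mathcal H'\oplus\mathcal H'$, to the multivalued part of $\Gamma$. Then $\Gamma_s\restriction T=\binom{\Gamma_0}{\Gamma_1}$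 for some boundary maps $\Gamma_0,\Gamma_1$ of $T$; so (1) applies to them. -/

import Mathlib

open Filter Topology
open scoped ENNReal

/-- `J` is a canonical symmetry of the Hilbert space `H`: `J = J⋆ = J⁻¹`.  Together with the form
`kreinForm J` the space `H` is then a Krein space (a `J`-space), and `⟨x, y⟩ = [x, J y]`. -/
def IsCanonicalSymmetry {H : Type*} [NormedAddCommGroup H] [InnerProductSpace ℂ H]
    [CompleteSpace H] (J : H →L[ℂ] H) : Prop :=
  IsSelfAdjoint J ∧ ∀ x, J (J x) = x

/-- The indefinite inner product `[x, y] = ⟨x, J y⟩`, conjugate-linear in the first factor. -/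
noncomputable def kreinForm {H : Type*} [NormedAddCommGroup H] [InnerProductSpace ℂ H]
    (J : H →L[ℂ] H) (x y : H) : ℂ :=
  inner ℂ x (J y)

/-- The indefinite metric `[(x₁, y₁), (x₂, y₂)]_Γ = -i ([x₁, y₂] - [y₁, x₂])` on the space of
graphs `H ⊕ H`. For a Hilbert space take `J = 1`. -/
noncomputable def graphForm {H : Type*} [NormedAddCommGroup H] [InnerProductSpace ℂ H]
    (J : H →L[ℂ] H) (p q : H × H) : ℂ :=
  -Complex.I * (kreinForm J p.1 q.2 - kreinForm J p.2 q.1)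

/-- The Hilbert scalar product `⟨x₁, x₂⟩ + ⟨y₁, y₂⟩` on `H ⊕ H`; on the graph of an operator `T`
it is the scalar product `⟨x, y⟩_T = ⟨x, y⟩ + ⟨T x, T y⟩` of the graph norm. -/
noncomputable def graphInner {H : Type*} [NormedAddCommGroup H] [InnerProductSpace ℂ H]
    (p q : H × H) : ℂ :=
  inner ℂ p.1 q.1 + inner ℂ p.2 q.2

/-- `T` is dissipative in the Krein space: `Im [x, T x] ≥ 0` on the domain of `T`. -/
def KreinDissipative {H : Type*} [NormedAddCommGroup H] [InnerProductSpace ℂ H]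
    (J : H →L[ℂ] H) (T : H →ₗ.[ℂ] H) : Prop :=
  ∀ x : T.domain, 0 ≤ (kreinForm J (x : H) (T x)).im

/-- The orthogonal complement of a subset `M` of the graph of `T` inside the graph of `T`, with
respect to the scalar product of the graph norm. -/
noncomputable def graphOrthogonal {H : Type*} [NormedAddCommGroup H] [InnerProductSpace ℂ H]
    (T : H →ₗ.[ℂ] H) (M : Set T.graph) : Submodule ℂ T.graph where
  carrier := {p | ∀ q ∈ M, graphInner (q : H × H) (p : H × H) = 0}
  zero_mem' := by
    intro q _
    simp [graphInner]
  add_mem' := by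
    intro a b ha hb q hq
    have h1 := ha q hq
    have h2 := hb q hq
    simp only [graphInner, Submodule.coe_add, Prod.fst_add, Prod.snd_add, inner_add_right]
      at h1 h2 ⊢
    linear_combination h1 + h2
  smul_mem' := by
    intro c a ha q hq
    have h1 := ha q hq
    simp only [graphInner, Submodule.coe_smul, Prod.smul_fst, Prod.smul_snd, inner_smul_right]
      at h1 ⊢
    linear_combination c * h1

/-- (The graph of) the symmetric part `S` of `T`, the restriction of `T` to
`Ker γ_T = {x ∈ D_T | γ_T[x] = 0}`, where `γ_T[x, y] = -i ([x, T y] - [T x, y])`, which is the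
indefinite metric of `H ⊕ H` evaluated at `(x, T x)` and `(y, T y)`. -/
def symmetricPart {H : Type*} [NormedAddCommGroup H] [InnerProductSpace ℂ H]
    (J : H →L[ℂ] H) (T : H →ₗ.[ℂ] H) : Set T.graph :=
  {p | graphForm J (p : H × H) (p : H × H) = 0}

/-- (The graph of) `N`, the restriction of `T` to the orthogonal complement of `D_S` in `D_T` with
respect to the scalar product of the graph norm. -/
noncomputable def dissipativePart {H : Type*} [NormedAddCommGroup H] [InnerProductSpace ℂ H]
    (J : H →L[ℂ] H) (T : H →ₗ.[ℂ] H) : Submodule ℂ T.graph :=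
  graphOrthogonal T (symmetricPart J T)

/-- The lineal `D` is complete with respect to the (semi)norm `q[x]^{1/2}` of the form `q`. -/
def FormComplete {E : Type*} [AddCommGroup E] [Module ℂ E] (q : E → E → ℂ)
    (D : Submodule ℂ E) : Prop :=
  ∀ s : ℕ → E, (∀ n, s n ∈ D) →
    (∀ ε : ℝ, 0 < ε → ∃ n₀, ∀ m ≥ n₀, ∀ n ≥ n₀, (q (s m - s n) (s m - s n)).re < ε) →
    ∃ x ∈ D, Tendsto (fun n => (q (s n - x) (s n - x)).re) atTop (𝓝 0)

/-! ### Linear relations -/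

/-- The linear relation `(A|K) (B|K)⁻¹ = {(B p, A p) | p ∈ K}`. -/
def restrictQuotient {E F G : Type*} [AddCommGroup E] [Module ℂ E] [AddCommGroup F] [Module ℂ F]
    [AddCommGroup G] [Module ℂ G] (A : E →ₗ[ℂ] F) (B : E →ₗ[ℂ] G) (K : Submodule ℂ E) :
    Submodule ℂ (G × F) :=
  K.map (B.prod A)

/-- The operator sup-norm of a linear relation, with values in `[0, ∞]`. -/
noncomputable def relNorm {E F : Type*} [NormedAddCommGroup E] [NormedSpace ℂ E]
    [NormedAddCommGroup F] [NormedSpace ℂ F] (R : Submodule ℂ (E × F)) : ℝ≥0∞ :=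
  ⨆ p ∈ R, ⨆ _ : ‖p.1‖ ≤ 1, ‖p.2‖ₑ

/-- The domain of a linear relation. -/
def relDomain {E F : Type*} [AddCommGroup E] [Module ℂ E] [AddCommGroup F] [Module ℂ F]
    (R : Submodule ℂ (E × F)) : Submodule ℂ E :=
  R.map (LinearMap.fst ℂ E F)

/-- The difference `R - Q = {(x, y - z) | (x, y) ∈ R, (x, z) ∈ Q}` of linear relations. -/
def relSub {E F : Type*} [AddCommGroup E] [Module ℂ E] [AddCommGroup F] [Module ℂ F]
    (R Q : Submodule ℂ (E × F)) : Submodule ℂ (E × F) where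
  carrier := {p | ∃ y z, (p.1, y) ∈ R ∧ (p.1, z) ∈ Q ∧ p.2 = y - z}
  zero_mem' := ⟨0, 0, R.zero_mem, Q.zero_mem, by simp⟩
  add_mem' := by
    rintro a b ⟨y, z, hy, hz, h⟩ ⟨y', z', hy', hz', h'⟩
    refine ⟨y + y', z + z', R.add_mem hy hy', Q.add_mem hz hz', ?_⟩
    rw [Prod.snd_add, h, h']
    abel
  smul_mem' := by
    rintro c a ⟨y, z, hy, hz, h⟩
    refine ⟨c • y, c • z, R.smul_mem c hy, Q.smul_mem c hz, ?_⟩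
    rw [Prod.smul_snd, h, smul_sub]

/-- The image `R(K) = {y | (x, y) ∈ R for some x ∈ K}` of a lineal `K` under a linear relation `R`;
only the part of `K` in the domain of `R` matters. -/
def relImage {E F : Type*} [AddCommGroup E] [Module ℂ E] [AddCommGroup F] [Module ℂ F]
    (R : Submodule ℂ (E × F)) (K : Submodule ℂ E) : Submodule ℂ F :=
  (R ⊓ K.comap (LinearMap.fst ℂ E F)).map (LinearMap.snd ℂ E F)

/-! ### Boundary maps -/

/-- `Γ₀, Γ₁` are boundary maps of `T`: bounded operators on (the graph of) `T` satisfying the Green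
identity, such that `(Γ₀, Γ₁)` vanishes on the symmetric part of `T` and has closed range. -/
structure IsBoundaryMaps {H H' : Type*} [NormedAddCommGroup H] [InnerProductSpace ℂ H]
    [NormedAddCommGroup H'] [InnerProductSpace ℂ H'] (J : H →L[ℂ] H) (T : H →ₗ.[ℂ] H)
    (Γ₀ Γ₁ : T.graph →L[ℂ] H') : Prop where
  green : ∀ p q : T.graph,
    kreinForm J (p : H × H).1 (q : H × H).2 - kreinForm J (p : H × H).2 (q : H × H).1 =
      inner ℂ (Γ₀ p) (Γ₁ q) - inner ℂ (Γ₁ p) (Γ₀ q)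
  vanish : ∀ p ∈ symmetricPart J T, Γ₀ p = 0 ∧ Γ₁ p = 0
  closedRange : IsClosed (Set.range fun p => (Γ₀ p, Γ₁ p))

/-- `Γ` is a unitary relation from `(H ⊕ H, [·,·]_Γ)` to `(H' ⊕ H', [·,·]'_Γ)`: its inverse is its
adjoint with respect to the indefinite metrics. -/
def IsUnitaryRelation {H H' : Type*} [NormedAddCommGroup H] [InnerProductSpace ℂ H]
    [NormedAddCommGroup H'] [InnerProductSpace ℂ H'] (J : H →L[ℂ] H)
    (Γ : Submodule ℂ ((H × H) × (H' × H'))) : Prop :=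
  ∀ (p : H × H) (u : H' × H'), (p, u) ∈ Γ ↔
    ∀ (q : H × H) (v : H' × H'), (q, v) ∈ Γ → graphForm J p q = graphForm 1 u v

/-- `(H', Γ)` is a unitary boundary pair for `S^c` with closed domain `D_Γ = S^c`, where `S` is the
symmetric part of `T` and `S^c` its orthogonal complement in `(H ⊕ H, [·,·]_Γ)`. -/
def IsUnitaryBoundaryPair {H H' : Type*} [NormedAddCommGroup H] [InnerProductSpace ℂ H]
    [NormedAddCommGroup H'] [InnerProductSpace ℂ H'] (J : H →L[ℂ] H) (T : H →ₗ.[ℂ] H)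
    (Γ : Submodule ℂ ((H × H) × (H' × H'))) : Prop :=
  IsUnitaryRelation J Γ ∧
    ∀ p : H × H, p ∈ relDomain Γ ↔ ∀ q ∈ symmetricPart J T, graphForm J p (q : H × H) = 0

/-- The operator part of `Γ`: the pairs in `Γ` whose second component is orthogonal to the
multivalued part of `Γ` in the Hilbert space `H' ⊕ H'`. -/
def operatorPart {H H' : Type*} [NormedAddCommGroup H] [InnerProductSpace ℂ H]
    [NormedAddCommGroup H'] [InnerProductSpace ℂ H']
    (Γ : Submodule ℂ ((H × H) × (H' × H'))) : Set ((H × H) × (H' × H')) :=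
  {z | z ∈ Γ ∧ ∀ w : H' × H', ((0 : H × H), w) ∈ Γ → graphInner w z.2 = 0}

/-! ### The objects of the criterion -/

/-- `S₁ = Ker Γ₁`. -/
def kerPart {H H' : Type*} [NormedAddCommGroup H] [InnerProductSpace ℂ H]
    [NormedAddCommGroup H'] [InnerProductSpace ℂ H'] (T : H →ₗ.[ℂ] H)
    (Γ₁ : T.graph →L[ℂ] H') : Submodule ℂ T.graph :=
  LinearMap.ker (Γ₁ : T.graph →ₗ[ℂ] H')

/-- `N₁`, the restriction of `T` to the orthogonal complement of `D_{S₁}` in the graph norm. -/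
noncomputable def kerPartCompl {H H' : Type*} [NormedAddCommGroup H] [InnerProductSpace ℂ H]
    [NormedAddCommGroup H'] [InnerProductSpace ℂ H'] (T : H →ₗ.[ℂ] H)
    (Γ₁ : T.graph →L[ℂ] H') : Submodule ℂ T.graph :=
  graphOrthogonal T (kerPart T Γ₁ : Set T.graph)

/-- `Θ₀₁ = (Γ₀|N₁) (Γ₁|N₁)⁻¹`, as a linear relation in `H'`. -/
noncomputable def theta01 {H H' : Type*} [NormedAddCommGroup H] [InnerProductSpace ℂ H]
    [NormedAddCommGroup H'] [InnerProductSpace ℂ H'] (T : H →ₗ.[ℂ] H)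
    (Γ₀ Γ₁ : T.graph →L[ℂ] H') : Submodule ℂ (H' × H') :=
  restrictQuotient (Γ₀ : T.graph →ₗ[ℂ] H') (Γ₁ : T.graph →ₗ[ℂ] H') (kerPartCompl T Γ₁)

/-- `Γ₀(S₁)`. -/
def imageKer {H H' : Type*} [NormedAddCommGroup H] [InnerProductSpace ℂ H]
    [NormedAddCommGroup H'] [InnerProductSpace ℂ H'] (T : H →ₗ.[ℂ] H)
    (Γ₀ Γ₁ : T.graph →L[ℂ] H') : Submodule ℂ H' :=
  (kerPart T Γ₁).map (Γ₀ : T.graph →ₗ[ℂ] H')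

/-! Part (1) concerns only the closed subspace `R`, the range of `(Γ₀, Γ₁)`. By the Green identity
the map `T → R` preserves the indefinite metrics. Dissipativity makes the metric nonnegative on `R`.
It is even definite there: a neutral vector of `R` comes from `S`, on which both boundary maps
vanish. Since the kernel of the pair is exactly `S`, already `N` is mapped onto `R`, and (a) and
(a') agree.

For a closed positive definite subspace three properties coincide: completeness in the metric,
uniform positivity, and being ortho-complemented (`tfae_formComplete_graphForm`). To see this,
compress the Gram operator to the subspace. This gives a positive injective operator `A`, and the
three properties say that `√A` has closed range, that `A` is bounded below, and that `A` is onto.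
Uniform positivity is (b), because `‖u₂ ± i u₁‖² = ‖u‖² ± [u, u]`. Ortho-complementedness is (c),
read off componentwise after writing `R` and its orthogonal companion in terms of `Θ₀₁`, `Θ₀₁*` and
`Γ₀(S₁)`.

In part (2) the open mapping theorem bounds the operator part on the closed domain `S^c`, and
unitarity yields the Green identity and the vanishing on `S`. For the closed range, the range of `Γ`
is the companion of its multivalued part by Riesz representation, so the operator part has closed
range. Its kernel lies in `S^cc = S ⊆ T`, hence `T` is a full preimage and its image is closed too.
-/

/-- The operator `(x, y) ↦ (-i J y, i J x)` which represents the indefinite metric of the space of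
graphs in the Hilbert space `H ⊕ H`. -/
noncomputable def graphOp {H : Type*} [NormedAddCommGroup H] [InnerProductSpace ℂ H]
    (J : H →L[ℂ] H) : WithLp 2 (H × H) →L[ℂ] WithLp 2 (H × H) :=
  ((WithLp.prodContinuousLinearEquiv 2 ℂ H H).symm : H × H →L[ℂ] WithLp 2 (H × H)) ∘L
    ((-Complex.I • (J ∘L ContinuousLinearMap.snd ℂ H H)).prod
      (Complex.I • (J ∘L ContinuousLinearMap.fst ℂ H H))) ∘L
    (WithLp.prodContinuousLinearEquiv 2 ℂ H H : WithLp 2 (H × H) →L[ℂ] H × H)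

/-! ### The indefinite metric on the space of graphs and its Gram operator. -/

section GraphForm

variable {H : Type*} [NormedAddCommGroup H] [InnerProductSpace ℂ H] {J : H →L[ℂ] H}

theorem graphInner_eq_inner (p q : H × H) :
    graphInner p q = inner ℂ (WithLp.toLp 2 p) (WithLp.toLp 2 q) := rfl

theorem graphForm_eq_inner (p q : H × H) :
    graphForm J p q = inner ℂ (WithLp.toLp 2 p) (graphOp J (WithLp.toLp 2 q)) := by
  simp [graphForm, kreinForm, graphOp, WithLp.prod_inner_apply, inner_smul_right]
  ring

theorem isCanonicalSymmetry_one [CompleteSpace H] : IsCanonicalSymmetry (1 : H →L[ℂ] H) :=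
  ⟨IsSelfAdjoint.one _, fun _ => rfl⟩

theorem IsCanonicalSymmetry.inner_left [CompleteSpace H] (hJ : IsCanonicalSymmetry J) (x y : H) :
    inner ℂ (J x) y = inner ℂ x (J y) :=
  (ContinuousLinearMap.isSelfAdjoint_iff_isSymmetric.mp hJ.1) x y

theorem graphOp_graphOp [CompleteSpace H] (hJ : IsCanonicalSymmetry J) (x : WithLp 2 (H × H)) :
    graphOp J (graphOp J x) = x := by
  apply (WithLp.equiv 2 (H × H)).injective
  ext <;> simp [graphOp, hJ.2, smul_smul]

theorem graphOp_inner_left [CompleteSpace H] (hJ : IsCanonicalSymmetry J)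
    (x y : WithLp 2 (H × H)) : inner ℂ (graphOp J x) y = inner ℂ x (graphOp J y) := by
  simp [graphOp, WithLp.prod_inner_apply, inner_smul_right, inner_smul_left, hJ.inner_left]
  ring

theorem conj_graphForm [CompleteSpace H] (hJ : IsCanonicalSymmetry J) (p q : H × H) :
    (starRingEnd ℂ) (graphForm J p q) = graphForm J q p := by
  rw [graphForm_eq_inner, graphForm_eq_inner, inner_conj_symm, graphOp_inner_left hJ]

theorem graphForm_eq_zero_comm [CompleteSpace H] (hJ : IsCanonicalSymmetry J) {p q : H × H} :
    graphForm J p q = 0 ↔ graphForm J q p = 0 := by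
  rw [← conj_graphForm hJ, map_eq_zero]

theorem graphForm_add_left (p p' q : H × H) :
    graphForm J (p + p') q = graphForm J p q + graphForm J p' q := by
  simp only [graphForm_eq_inner, WithLp.toLp_add, inner_add_left]

theorem graphForm_add_right (p q q' : H × H) :
    graphForm J p (q + q') = graphForm J p q + graphForm J p q' := by
  simp only [graphForm_eq_inner, WithLp.toLp_add, map_add, inner_add_right]

theorem graphForm_sub_right (p q q' : H × H) :
    graphForm J p (q - q') = graphForm J p q - graphForm J p q' := by
  simp only [graphForm_eq_inner, WithLp.toLp_sub, map_sub, inner_sub_right]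

theorem graphForm_smul_left (c : ℂ) (p q : H × H) :
    graphForm J (c • p) q = (starRingEnd ℂ) c * graphForm J p q := by
  simp only [graphForm_eq_inner, WithLp.toLp_smul, inner_smul_left]

theorem graphForm_smul_right (c : ℂ) (p q : H × H) :
    graphForm J p (c • q) = c * graphForm J p q := by
  simp only [graphForm_eq_inner, WithLp.toLp_smul, map_smul, inner_smul_right]

theorem graphForm_zero_left (q : H × H) : graphForm J 0 q = 0 := by
  simp [graphForm, kreinForm]

theorem continuous_graphForm_left (q : H × H) : Continuous fun p => graphForm J p q := by
  unfold graphForm kreinForm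
  fun_prop

theorem continuous_graphForm_right (p : H × H) : Continuous fun q => graphForm J p q := by
  unfold graphForm kreinForm
  fun_prop

theorem continuous_graphInner_right (p : H × H) : Continuous fun q => graphInner p q := by
  unfold graphInner
  fun_prop

/-- Orthogonal decomposition of the Hilbert space `H ⊕ H` along a closed subspace. -/
theorem exists_sub_graphInner_eq_zero [CompleteSpace H] (M : Submodule ℂ (H × H))
    (hM : IsClosed (M : Set (H × H))) (p : H × H) :
    ∃ m ∈ M, ∀ q ∈ M, graphInner q (p - m) = 0 := by
  let M' : Submodule ℂ (WithLp 2 (H × H)) :=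
    M.comap (WithLp.prodContinuousLinearEquiv 2 ℂ H H : WithLp 2 (H × H) →ₗ[ℂ] H × H)
  have hM' : IsClosed (M' : Set (WithLp 2 (H × H))) :=
    hM.preimage (WithLp.prodContinuousLinearEquiv 2 ℂ H H).continuous
  have : CompleteSpace M' := hM'.completeSpace_coe
  have hm := M'.starProjection_apply_mem (WithLp.toLp 2 p)
  refine ⟨WithLp.ofLp (M'.starProjection (WithLp.toLp 2 p)), hm, fun q hq => ?_⟩
  rw [graphInner_eq_inner, WithLp.toLp_sub]
  exact M'.sub_starProjection_mem_orthogonal (WithLp.toLp 2 p) (WithLp.toLp 2 q) hq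

/-- A closed operator has a closed graph, so a subspace closed in the graph is closed in `H ⊕ H` and
the Hilbert space projection applies. -/
theorem exists_mem_graphOrthogonal [CompleteSpace H] {T : H →ₗ.[ℂ] H} (hT : T.IsClosed)
    (M : Submodule ℂ T.graph) (hM : IsClosed (M : Set T.graph)) (p : T.graph) :
    ∃ m ∈ M, p - m ∈ graphOrthogonal T (M : Set T.graph) := by
  have hcl : IsClosed (M.map T.graph.subtype : Set (H × H)) := by
    rw [Submodule.map_coe]
    exact (hT.isClosedEmbedding_subtypeVal.isClosedMap) _ hM
  obtain ⟨_, ⟨m, hm, rfl⟩, h⟩ := exists_sub_graphInner_eq_zero _ hcl (p : H × H)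
  exact ⟨m, hm, fun q hq => h q ⟨q, hq, rfl⟩⟩

/-- A closed subspace of `H ⊕ H` is its own double orthogonal companion. -/
theorem mem_of_forall_graphForm_eq_zero [CompleteSpace H] (hJ : IsCanonicalSymmetry J)
    (M : Submodule ℂ (H × H)) (hM : IsClosed (M : Set (H × H))) (p : H × H)
    (h : ∀ q, (∀ m ∈ M, graphForm J m q = 0) → graphForm J p q = 0) : p ∈ M := by
  obtain ⟨m, hm, horth⟩ := exists_sub_graphInner_eq_zero M hM p
  set r := p - m with hr
  -- The Gram operator is an involution, so it turns Hilbert orthogonality to `M` into orthogonality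
  -- in the indefinite metric.
  have key : ∀ s, graphForm J s (WithLp.ofLp (graphOp J (WithLp.toLp 2 r))) = graphInner s r := by
    intro s
    rw [graphForm_eq_inner, WithLp.toLp_ofLp, graphOp_graphOp hJ, graphInner_eq_inner]
  have h1 : graphInner p r = 0 := by
    rw [← key]
    exact h _ fun s hs => by rw [key, horth s hs]
  have h2 : graphInner r r = 0 := by
    have : graphInner r r = graphInner p r - graphInner m r := by
      simp only [graphInner_eq_inner, hr, WithLp.toLp_sub, inner_sub_left]
    rw [this, h1, horth m hm, sub_zero]
  rw [graphInner_eq_inner, inner_self_eq_zero, WithLp.toLp_eq_zero] at h2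
  rwa [sub_eq_zero.mp h2]

end GraphForm

/-! ### Completeness in a form, uniform positivity and ortho-complementedness. -/

section FormComplete

/-- Completeness sees only the values `q x x` on `D`, and sequences in the image can be lifted.
Injectivity of `f` is therefore not needed. -/
theorem formComplete_map_iff {E F : Type*} [AddCommGroup E] [Module ℂ E] [AddCommGroup F]
    [Module ℂ F] {q : E → E → ℂ} {q' : F → F → ℂ} {D : Submodule ℂ E} {D' : Submodule ℂ F}
    (f : E →ₗ[ℂ] F) (hf : D.map f = D') (hq : ∀ x ∈ D, q' (f x) (f x) = q x x) :
    FormComplete q' D' ↔ FormComplete q D := by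
  subst hf
  constructor
  · intro h s hs hc
    obtain ⟨_, ⟨x, hx, rfl⟩, hlim⟩ := h (fun n => f (s n)) (fun n => ⟨_, hs n, rfl⟩) (by
      intro ε hε
      obtain ⟨n₀, hn⟩ := hc ε hε
      refine ⟨n₀, fun m hm n hn' => ?_⟩
      rw [← map_sub, hq _ (D.sub_mem (hs m) (hs n))]
      exact hn m hm n hn')
    refine ⟨x, hx, hlim.congr fun n => ?_⟩
    rw [← map_sub, hq _ (D.sub_mem (hs n) hx)]
  · intro h s hs hc
    choose t ht hts using hs
    obtain ⟨x, hx, hlim⟩ := h t ht (by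
      intro ε hε
      obtain ⟨n₀, hn⟩ := hc ε hε
      refine ⟨n₀, fun m hm n hn' => ?_⟩
      rw [← hq _ (D.sub_mem (ht m) (ht n)), map_sub, hts, hts]
      exact hn m hm n hn')
    refine ⟨f x, ⟨x, hx, rfl⟩, hlim.congr fun n => ?_⟩
    rw [← hq _ (D.sub_mem (ht n) hx), map_sub, hts]

variable {E : Type*} [NormedAddCommGroup E] [InnerProductSpace ℂ E] [CompleteSpace E]

/-- The seminorm `‖B x‖` is complete exactly when `B` has closed range. -/
theorem formComplete_iff_isClosed_range (B : E →L[ℂ] E) (q : E → E → ℂ)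
    (hq : ∀ x, (q x x).re = ‖B x‖ ^ 2) : FormComplete q ⊤ ↔ IsClosed (Set.range B) := by
  constructor
  · intro h
    refine IsSeqClosed.isClosed fun y z hy hyz => ?_
    choose s hs using hy
    obtain ⟨x, -, hx⟩ := h s (fun _ => trivial) (by
      intro ε hε
      obtain ⟨n₀, hn⟩ := Metric.cauchySeq_iff.mp hyz.cauchySeq (√ε) (Real.sqrt_pos.mpr hε)
      refine ⟨n₀, fun m hm n hn' => ?_⟩
      rw [hq, map_sub, hs, hs, ← dist_eq_norm]
      exact (Real.lt_sqrt dist_nonneg).mp (hn m hm n hn'))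
    refine ⟨x, tendsto_nhds_unique ?_ hyz⟩
    rw [tendsto_iff_norm_sub_tendsto_zero]
    have h2 := hx.sqrt
    rw [Real.sqrt_zero] at h2
    refine h2.congr fun n => ?_
    rw [hq, map_sub, hs, Real.sqrt_sq (norm_nonneg _), norm_sub_rev]
  · intro h s _ hc
    have hcau : CauchySeq fun n => B (s n) := by
      refine Metric.cauchySeq_iff.mpr fun ε hε => ?_
      obtain ⟨n₀, hn⟩ := hc (ε ^ 2) (by positivity)
      refine ⟨n₀, fun m hm n hn' => ?_⟩
      have := hn m hm n hn'
      rw [hq, map_sub, ← dist_eq_norm] at this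
      exact lt_of_pow_lt_pow_left₀ 2 hε.le this
    obtain ⟨y, hy⟩ := cauchySeq_tendsto_of_complete hcau
    obtain ⟨x, rfl⟩ := h.mem_of_tendsto hy (Eventually.of_forall fun n => ⟨s n, rfl⟩)
    refine ⟨x, trivial, ?_⟩
    have := (tendsto_iff_norm_sub_tendsto_zero.mp hy).pow 2
    simpa only [hq, map_sub, ne_eq, OfNat.ofNat_ne_zero, not_false_eq_true, zero_pow] using this

theorem isClosed_range_iff_exists_le (B : E →L[ℂ] E) (hB : Function.Injective B) :
    IsClosed (Set.range B) ↔ ∃ c : ℝ, 0 < c ∧ ∀ x, c * ‖x‖ ^ 2 ≤ ‖B x‖ ^ 2 := by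
  rw [B.isClosed_range_iff_antilipschitz_of_injective hB]
  constructor
  · rintro ⟨K, hK⟩
    refine ⟨((K : ℝ) ^ 2 + 1)⁻¹, by positivity, fun x => ?_⟩
    have h1 : ‖x‖ ^ 2 ≤ (K * ‖B x‖) ^ 2 :=
      pow_le_pow_left₀ (norm_nonneg _) (by simpa using hK.le_mul_dist x 0) 2
    rw [inv_mul_le_iff₀ (by positivity)]
    nlinarith [sq_nonneg ‖B x‖]
  · rintro ⟨c, hc, h⟩
    refine ⟨(√c)⁻¹.toNNReal, B.antilipschitz_of_bound fun x => ?_⟩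
    rw [Real.coe_toNNReal _ (by positivity), le_inv_mul_iff₀ (Real.sqrt_pos.mpr hc)]
    refine le_of_sq_le_sq ?_ (norm_nonneg _)
    rw [mul_pow, Real.sq_sqrt hc.le]
    exact h x

/-- A positive injective operator `A` on a Hilbert space defines a complete norm exactly when it
is uniformly positive, and exactly when it is surjective. -/
theorem ContinuousLinearMap.IsPositive.tfae_formComplete {A : E →L[ℂ] E} (hA : A.IsPositive)
    (hinj : Function.Injective A) :
    List.TFAE [FormComplete (fun x y => inner ℂ x (A y)) ⊤,
      ∃ c : ℝ, 0 < c ∧ ∀ x, c * ‖x‖ ^ 2 ≤ (inner ℂ x (A x)).re,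
      Function.Surjective A] := by
  -- The square root of `A` turns the form into `‖B x‖²`, so all three conditions become statements
  -- about the range of `B`.
  obtain ⟨B, hBs, hBA⟩ : ∃ B : E →L[ℂ] E, IsSelfAdjoint B ∧ ∀ x, B (B x) = A x := by
    have h0 : 0 ≤ A := (ContinuousLinearMap.nonneg_iff_isPositive A).mpr hA
    refine ⟨CFC.sqrt A, (CFC.sqrt_nonneg A).isSelfAdjoint, fun x => ?_⟩
    exact DFunLike.congr_fun (CFC.sqrt_mul_sqrt_self A h0) x
  have hq : ∀ x, (inner ℂ x (A x)).re = ‖B x‖ ^ 2 := fun x => by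
    have h := (ContinuousLinearMap.isSelfAdjoint_iff_isSymmetric.mp hBs) x (B x)
    rw [← hBA]
    refine (congrArg Complex.re h.symm).trans ?_
    exact inner_self_eq_norm_sq (𝕜 := ℂ) (B x)
  have hBinj : Function.Injective B := fun x y h => hinj (by rw [← hBA, ← hBA, h])
  have hBker : B.ker = ⊥ := LinearMap.ker_eq_bot.mpr hBinj
  have hsurj : IsClosed (Set.range B) ↔ Function.Surjective A := by
    constructor
    · intro h
      have : CompleteSpace B.range := (show IsClosed (B.range : Set E) from h).completeSpace_coe
      -- The range of a self-adjoint injective operator is dense.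
      have hB : B.range = ⊤ := by
        rw [← Submodule.orthogonal_eq_bot_iff, B.orthogonal_range, hBs.adjoint_eq, hBker]
      intro y
      obtain ⟨z, rfl⟩ := LinearMap.range_eq_top.mp hB y
      obtain ⟨x, rfl⟩ := LinearMap.range_eq_top.mp hB z
      exact ⟨x, (hBA x).symm⟩
    · intro h
      have hB : Function.Surjective B := fun y => by
        obtain ⟨x, rfl⟩ := h y
        exact ⟨B x, hBA x⟩
      rw [hB.range_eq]
      exact isClosed_univ
  have h1 := formComplete_iff_isClosed_range B (fun x y => inner ℂ x (A y)) hq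
  have h2 := isClosed_range_iff_exists_le B hBinj
  simp only [← hq] at h2
  tfae_have 1 ↔ 2 := h1.trans h2
  tfae_have 2 ↔ 3 := h2.symm.trans hsurj
  tfae_finish

/-- For a closed positive definite subspace `M` of a Krein space with canonical symmetry `𝒥`,
completeness in the indefinite metric, uniform positivity and ortho-complementedness agree. -/
theorem tfae_formComplete_subspace {𝒥 : E →L[ℂ] E} (h𝒥 : IsCanonicalSymmetry 𝒥)
    (M : Submodule ℂ E) (hM : IsClosed (M : Set E))
    (hpos : ∀ x ∈ M, 0 ≤ (inner ℂ x (𝒥 x)).re)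
    (hdef : ∀ x ∈ M, inner ℂ x (𝒥 x) = 0 → x = 0) :
    List.TFAE [FormComplete (fun x y => inner ℂ x (𝒥 y)) M,
      ∃ c : ℝ, 0 < c ∧ ∀ x ∈ M, c * ‖x‖ ^ 2 ≤ (inner ℂ x (𝒥 x)).re,
      ∀ y, ∃ x ∈ M, ∀ z ∈ M, inner ℂ z (𝒥 (y - x)) = 0] := by
  have : CompleteSpace M := hM.completeSpace_coe
  -- The compression of `𝒥` to `M`, which represents the indefinite form on `M`.
  let A : M →L[ℂ] M := M.subtypeL.adjoint ∘L 𝒥 ∘L M.subtypeL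
  have hA : ∀ x y : M, inner ℂ x (A y) = inner ℂ (x : E) (𝒥 y) := fun x y => by
    simp only [A, ContinuousLinearMap.comp_apply, ContinuousLinearMap.adjoint_inner_right]
    rfl
  have hApos : A.IsPositive := by
    refine ContinuousLinearMap.isPositive_def.mpr ⟨fun x y => ?_, fun x => ?_⟩
    · change inner ℂ (A x) y = inner ℂ x (A y)
      rw [← inner_conj_symm, hA, hA, inner_conj_symm, h𝒥.inner_left]
    · rw [ContinuousLinearMap.reApplyInnerSelf_apply, inner_re_symm, hA]
      exact hpos x x.2
  have hAinj : Function.Injective A := by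
    refine (injective_iff_map_eq_zero A).mpr fun x hx => ?_
    refine Subtype.ext (hdef x x.2 ?_)
    rw [← hA, hx, inner_zero_right]
  have h12 := (hApos.tfae_formComplete hAinj).out 0 1
  have h23 := (hApos.tfae_formComplete hAinj).out 1 2
  simp only [hA, Subtype.forall, Submodule.coe_norm] at h12 h23
  tfae_have 1 ↔ 2 := by
    rw [← h12]
    exact formComplete_map_iff M.subtype (by simp) fun x _ => rfl
  -- `y - x` is orthogonal to `M` exactly when `A x` is the projection of `𝒥 y` to `M`. As `𝒥` is
  -- onto, these projections exhaust `M`.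
  tfae_have 2 ↔ 3 := by
    rw [h23]
    constructor
    · intro hs y
      obtain ⟨x, hx⟩ := hs (M.subtypeL.adjoint (𝒥 y))
      refine ⟨x, x.2, fun z hz => ?_⟩
      have h1 := hA ⟨z, hz⟩ x
      rw [hx, ContinuousLinearMap.adjoint_inner_right] at h1
      rw [map_sub, inner_sub_right, sub_eq_zero]
      exact h1
    · intro hs e
      obtain ⟨x, hx, h⟩ := hs (𝒥 e)
      refine ⟨⟨x, hx⟩, ext_inner_left ℂ fun z => ?_⟩
      have h1 := h z z.2
      rw [map_sub, h𝒥.2, inner_sub_right, sub_eq_zero] at h1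
      rw [hA, ← h1]
      rfl
  tfae_finish

end FormComplete

/-! ### Subspaces of the boundary space: Cayley transform and range conditions. -/

section BoundarySubspace

variable {F : Type*} [NormedAddCommGroup F] [InnerProductSpace ℂ F]

/-- The product `F × F` carries the sup norm, so the Hilbert space result is transported from
`WithLp 2 (F × F)`. -/
theorem tfae_formComplete_graphForm [CompleteSpace F] {J : F →L[ℂ] F} (hJ : IsCanonicalSymmetry J)
    (R : Submodule ℂ (F × F)) (hR : IsClosed (R : Set (F × F)))
    (hpos : ∀ u ∈ R, 0 ≤ (graphForm J u u).re) (hdef : ∀ u ∈ R, graphForm J u u = 0 → u = 0) :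
    List.TFAE [FormComplete (graphForm J) R,
      ∃ c : ℝ, 0 < c ∧ ∀ u ∈ R, c * (‖u.1‖ ^ 2 + ‖u.2‖ ^ 2) ≤ (graphForm J u u).re,
      ∀ v, ∃ u ∈ R, ∀ w ∈ R, graphForm J w (v - u) = 0] := by
  let e := WithLp.prodContinuousLinearEquiv 2 ℂ F F
  let M : Submodule ℂ (WithLp 2 (F × F)) := R.comap (e : WithLp 2 (F × F) →ₗ[ℂ] F × F)
  have hM : IsClosed (M : Set (WithLp 2 (F × F))) := hR.preimage e.continuous
  have hJ' : IsCanonicalSymmetry (graphOp J) :=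
    ⟨ContinuousLinearMap.isSelfAdjoint_iff_isSymmetric.mpr fun x y => graphOp_inner_left hJ x y,
      graphOp_graphOp hJ⟩
  have key := tfae_formComplete_subspace hJ' M hM
    (fun x hx => by
      have := hpos (WithLp.ofLp x) hx
      rwa [graphForm_eq_inner] at this)
    (fun x hx h => by
      have := hdef (WithLp.ofLp x) hx (by rw [graphForm_eq_inner]; exact h)
      exact (WithLp.ofLp_eq_zero 2).mp this)
  have h1 : FormComplete (graphForm J) R ↔
      FormComplete (fun x y => inner ℂ x (graphOp J y)) M :=
    formComplete_map_iff (e : WithLp 2 (F × F) →ₗ[ℂ] F × F)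
      (Submodule.map_comap_eq_of_surjective e.surjective R)
      fun x _ => graphForm_eq_inner _ _
  have h2 : (∃ c : ℝ, 0 < c ∧ ∀ u ∈ R, c * (‖u.1‖ ^ 2 + ‖u.2‖ ^ 2) ≤ (graphForm J u u).re) ↔
      ∃ c : ℝ, 0 < c ∧ ∀ x ∈ M, c * ‖x‖ ^ 2 ≤ (inner ℂ x (graphOp J x)).re := by
    refine exists_congr fun c => and_congr_right fun _ => ?_
    constructor
    · intro h x hx
      have := h (WithLp.ofLp x) hx
      rw [graphForm_eq_inner] at this
      rwa [WithLp.prod_norm_sq_eq_of_L2]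
    · intro h u hu
      have := h (WithLp.toLp 2 u) hu
      rwa [WithLp.prod_norm_sq_eq_of_L2, ← graphForm_eq_inner] at this
  have h3 : (∀ v, ∃ u ∈ R, ∀ w ∈ R, graphForm J w (v - u) = 0) ↔
      ∀ y, ∃ x ∈ M, ∀ z ∈ M, inner ℂ z (graphOp J (y - x)) = 0 := by
    constructor
    · intro h y
      obtain ⟨u, hu, hw⟩ := h (WithLp.ofLp y)
      refine ⟨WithLp.toLp 2 u, hu, fun z hz => ?_⟩
      have := hw (WithLp.ofLp z) hz
      rwa [graphForm_eq_inner] at this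
    · intro h v
      obtain ⟨x, hx, hz⟩ := h (WithLp.toLp 2 v)
      refine ⟨WithLp.ofLp x, hx, fun w hw => ?_⟩
      rw [graphForm_eq_inner]
      exact hz (WithLp.toLp 2 w) hw
  rw [h1, h2, h3]
  exact key

theorem graphForm_one (u v : F × F) :
    graphForm (1 : F →L[ℂ] F) u v = -Complex.I * (inner ℂ u.1 v.2 - inner ℂ u.2 v.1) := rfl

theorem norm_sq_add_I_smul (u : F × F) : ‖u.2 + Complex.I • u.1‖ ^ 2 =
    ‖u.1‖ ^ 2 + ‖u.2‖ ^ 2 + (graphForm (1 : F →L[ℂ] F) u u).re := by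
  have h : (inner ℂ u.1 u.2).im = -(inner ℂ u.2 u.1).im := inner_im_symm (𝕜 := ℂ) u.1 u.2
  rw [@norm_add_sq ℂ, norm_smul, Complex.norm_I, one_mul, inner_smul_right, graphForm_one]
  simp [Complex.mul_re, h]
  ring

theorem norm_sq_sub_I_smul (u : F × F) : ‖u.2 - Complex.I • u.1‖ ^ 2 =
    ‖u.1‖ ^ 2 + ‖u.2‖ ^ 2 - (graphForm (1 : F →L[ℂ] F) u u).re := by
  have h : (inner ℂ u.1 u.2).im = -(inner ℂ u.2 u.1).im := inner_im_symm (𝕜 := ℂ) u.1 u.2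
  rw [@norm_sub_sq ℂ, norm_smul, Complex.norm_I, one_mul, inner_smul_right, graphForm_one]
  simp [Complex.mul_re, h]
  ring

/-- The Cayley transform of a nonnegative subspace is a strict contraction exactly when the
subspace is uniformly positive. -/
theorem relNorm_lt_one_iff (R Q : Submodule ℂ (F × F))
    (hQ : ∀ p, p ∈ Q ↔ ∃ u ∈ R, p = (u.2 + Complex.I • u.1, u.2 - Complex.I • u.1))
    (hpos : ∀ u ∈ R, 0 ≤ (graphForm (1 : F →L[ℂ] F) u u).re) :
    relNorm Q < 1 ↔ ∃ c : ℝ, 0 < c ∧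
      ∀ u ∈ R, c * (‖u.1‖ ^ 2 + ‖u.2‖ ^ 2) ≤ (graphForm (1 : F →L[ℂ] F) u u).re := by
  constructor
  · intro h
    obtain ⟨k, hk, hk1⟩ : ∃ k : ℝ, 0 ≤ k ∧ k < 1 ∧ ∀ p ∈ Q, ‖p.1‖ ≤ 1 → ‖p.2‖ ≤ k := by
      refine ⟨(relNorm Q).toReal, ENNReal.toReal_nonneg, ?_, fun p hp hp1 => ?_⟩
      · simpa using (ENNReal.toReal_lt_toReal h.ne_top ENNReal.one_ne_top).mpr h
      · have h2 : ‖p.2‖ₑ ≤ relNorm Q :=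
          le_iSup₂_of_le (f := fun p (_ : p ∈ Q) => ⨆ _ : ‖p.1‖ ≤ 1, ‖p.2‖ₑ) p hp
            (le_iSup_of_le hp1 le_rfl)
        simpa using ENNReal.toReal_mono h.ne_top h2
    obtain ⟨hk1, hb⟩ := hk1
    -- With `n = ‖u₁‖² + ‖u₂‖²` and `g = [u, u]`, contractivity reads `n - g ≤ k² (n + g)`. Hence
    -- `(1 - k²) n ≤ (1 + k²) g ≤ 2 g`.
    refine ⟨(1 - k ^ 2) / 2, by nlinarith, fun u hu => ?_⟩
    have ha := norm_sq_add_I_smul u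
    have hb' := norm_sq_sub_I_smul u
    have hp := hpos u hu
    have hbound : ‖u.2 - Complex.I • u.1‖ ≤ k * ‖u.2 + Complex.I • u.1‖ := by
      -- If the first component vanishes, then `n + g = 0`, and `g ≥ 0` forces the second component
      -- to vanish as well.
      rcases eq_or_ne (‖u.2 + Complex.I • u.1‖) 0 with h0 | h0
      · rw [h0, mul_zero]
        have : ‖u.2 - Complex.I • u.1‖ ^ 2 ≤ 0 := by rw [h0] at ha; linarith
        nlinarith
      · set r := ‖u.2 + Complex.I • u.1‖ with hr
        have hrpos : 0 < r := lt_of_le_of_ne (norm_nonneg _) h0.symm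
        have hn : ‖((r⁻¹ : ℝ) : ℂ)‖ = r⁻¹ := by simp [abs_of_pos hrpos]
        have := hb _ (Q.smul_mem ((r⁻¹ : ℝ) : ℂ) ((hQ _).mpr ⟨u, hu, rfl⟩)) (by
          rw [Prod.smul_fst, norm_smul, hn, ← hr, inv_mul_cancel₀ h0])
        rw [Prod.smul_snd, norm_smul, hn, inv_mul_le_iff₀ hrpos] at this
        linarith
    have hsq := pow_le_pow_left₀ (norm_nonneg _) hbound 2
    rw [mul_pow] at hsq
    have hk2 : 0 ≤ 1 - k ^ 2 := by nlinarith
    have := mul_nonneg hk2 hp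
    nlinarith
  · rintro ⟨c, hc, h⟩
    -- The maximum covers `c > 1`, which is possible when `R` is trivial.
    have hlt : √(max 0 (1 - c)) < 1 := by
      rw [Real.sqrt_lt' one_pos]
      exact max_lt (by norm_num) (by linarith)
    refine lt_of_le_of_lt (b := ENNReal.ofReal √(max 0 (1 - c))) ?_ ?_
    · refine iSup₂_le fun p hp => iSup_le fun hp1 => ?_
      obtain ⟨u, hu, rfl⟩ := (hQ p).mp hp
      rw [← ofReal_norm]
      refine ENNReal.ofReal_le_ofReal (Real.le_sqrt_of_sq_le ?_)
      have ha := norm_sq_add_I_smul u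
      have hb := norm_sq_sub_I_smul u
      have hu' := h u hu
      have hp1' : ‖u.2 + Complex.I • u.1‖ ^ 2 ≤ 1 := pow_le_one₀ (norm_nonneg _) hp1
      have hb0 := sq_nonneg ‖u.2 - Complex.I • u.1‖
      -- Nonnegativity of `n - g` gives `c (n + g) ≤ 2 c n ≤ 2 g`, which is this bound rearranged.
      have h1 : ‖u.2 - Complex.I • u.1‖ ^ 2 ≤ (1 - c) * ‖u.2 + Complex.I • u.1‖ ^ 2 := by
        nlinarith [mul_nonneg hc.le hb0]
      calc _ ≤ (1 - c) * ‖u.2 + Complex.I • u.1‖ ^ 2 := h1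
        _ ≤ max 0 (1 - c) * ‖u.2 + Complex.I • u.1‖ ^ 2 := by gcongr; exact le_max_right _ _
        _ ≤ max 0 (1 - c) := mul_le_of_le_one_right (le_max_left _ _) hp1'
    · rw [← ENNReal.ofReal_one]
      exact (ENNReal.ofReal_lt_ofReal_iff one_pos).mpr hlt

/-- The subspace of all `(y + m, x)` with `(x, y) ∈ Θ`, `m ∈ M` is ortho-complemented in the
metric of `F ⊕ F` exactly when two range conditions on `Θ`, its adjoint and `M` hold. -/
theorem forall_exists_graphForm_eq_zero_iff (R Θ : Submodule ℂ (F × F)) (M : Submodule ℂ F)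
    (hR : ∀ u, u ∈ R ↔ ∃ y, (u.2, y) ∈ Θ ∧ ∃ m ∈ M, u.1 = y + m) :
    (∀ v, ∃ u ∈ R, ∀ w ∈ R, graphForm (1 : F →L[ℂ] F) w (v - u) = 0) ↔
      R.map (LinearMap.snd ℂ F F) ⊔ (relDomain Θ.adjoint ⊓ Mᗮ) = ⊤ ∧
        relImage (relSub Θ.adjoint Θ) Mᗮ ⊔ M = ⊤ := by
  have hΘR : ∀ {x y}, (x, y) ∈ Θ → (y, x) ∈ R := fun h =>
    (hR _).mpr ⟨_, h, 0, M.zero_mem, (add_zero _).symm⟩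
  have hMR : ∀ {m}, m ∈ M → (m, (0 : F)) ∈ R := fun h =>
    (hR _).mpr ⟨0, Θ.zero_mem, _, h, (zero_add _).symm⟩
  -- The orthogonal companion of `R`: testing against `Θ` gives the adjoint, testing against `M ⊕ 0`
  -- gives orthogonality to `M`.
  have hRc : ∀ z : F × F, (∀ w ∈ R, graphForm (1 : F →L[ℂ] F) w z = 0) ↔
      (z.2, z.1) ∈ Θ.adjoint ∧ z.2 ∈ Mᗮ := by
    intro z
    simp only [graphForm_one, mul_eq_zero, neg_eq_zero, Complex.I_ne_zero, false_or,
      Submodule.mem_adjoint_iff, Submodule.mem_orthogonal]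
    constructor
    · intro h
      refine ⟨fun a b hab => h _ (hΘR hab), fun m hm => ?_⟩
      simpa using h _ (hMR hm)
    · rintro ⟨h1, h2⟩ w hw
      obtain ⟨y, hy, m, hm, hw1⟩ := (hR w).mp hw
      rw [hw1, inner_add_left, h2 m hm, add_zero]
      exact h1 _ _ hy
  simp only [hRc]
  constructor
  · intro h
    refine ⟨(Submodule.eq_top_iff'.mpr fun a => ?_), (Submodule.eq_top_iff'.mpr fun a => ?_)⟩
    -- Decomposing `(0, a)` yields the first range condition; decomposing `(a, 0)` yields the
    -- second.
    · obtain ⟨u, hu, h1, h2⟩ := h (0, a)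
      refine Submodule.mem_sup.mpr ⟨u.2, ⟨u, hu, rfl⟩, _, ⟨⟨_, h1, rfl⟩, h2⟩, ?_⟩
      simp
    · obtain ⟨u, hu, h1, h2⟩ := h (a, 0)
      obtain ⟨y, hy, m, hm, hw1⟩ := (hR u).mp hu
      refine Submodule.mem_sup.mpr ⟨a - m, ⟨(-u.2, a - m), ⟨⟨a - u.1, -y, ?_, ?_, ?_⟩, ?_⟩, rfl⟩,
        m, hm, sub_add_cancel _ _⟩
      · simpa using h1
      · simpa using Θ.neg_mem hy
      · change a - m = a - u.1 - -y
        rw [hw1]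
        abel
      · simpa using h2
  · rintro ⟨h1, h2⟩ v
    -- The first condition splits `v.2`. The second condition then absorbs the error left in the
    -- first component, through a correction `(z, x)` whose entry `x` is balanced between `R` and
    -- its companion.
    obtain ⟨_, ⟨u₁, hu₁, rfl⟩, a, ⟨⟨⟨a', b⟩, hab, haa⟩, ha⟩, hv⟩ :=
      Submodule.mem_sup.mp (Submodule.eq_top_iff'.mp h1 v.2)
    obtain ⟨_, ⟨⟨x, k⟩, ⟨⟨y, z, hy, hz, hk⟩, hx⟩, rfl⟩, m, hm, hv'⟩ :=
      Submodule.mem_sup.mp (Submodule.eq_top_iff'.mp h2 (v.1 - u₁.1 - b))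
    simp only [LinearMap.fst_apply, LinearMap.snd_apply] at haa hv hv' hk hy hz
    subst haa
    have hv1 : v.1 = u₁.1 - z + m + (b + y) := by
      rw [hk, eq_sub_iff_add_eq, eq_sub_iff_add_eq] at hv'
      rw [← hv']
      abel
    refine ⟨u₁ - (z, x) + (m, 0), R.add_mem (R.sub_mem hu₁ (hΘR hz)) (hMR hm), ?_, ?_⟩
    · have := Θ.adjoint.add_mem hab hy
      convert this using 1
      ext
      · simp [← hv]
      · simp [hv1]
    · have := Mᗮ.add_mem ha hx
      convert this using 1
      simp [← hv]

end BoundarySubspace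

/-! ### The symmetric part of a dissipative operator. -/

section Dissipative

variable {H : Type*} [NormedAddCommGroup H] [InnerProductSpace ℂ H] [CompleteSpace H]
  {J : H →L[ℂ] H} {T : H →ₗ.[ℂ] H}

theorem KreinDissipative.re_graphForm_nonneg (hJ : IsCanonicalSymmetry J)
    (hT : KreinDissipative J T) (p : T.graph) :
    0 ≤ (graphForm J (p : H × H) (p : H × H)).re := by
  obtain ⟨⟨a, b⟩, hp⟩ := p
  obtain ⟨x, hx, hTx⟩ := (LinearPMap.mem_graph_iff T).mp hp
  simp only at hx hTx
  subst hx hTx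
  have h1 := hT x
  have h2 : kreinForm J (T x) (x : H) = (starRingEnd ℂ) (kreinForm J (x : H) (T x)) := by
    rw [kreinForm, kreinForm, ← hJ.inner_left, inner_conj_symm]
  simp only [graphForm, h2]
  simp [Complex.mul_re]
  linarith

/-- The Cauchy–Schwarz inequality in the degenerate case. -/
theorem graphForm_eq_zero_of_mem_symmetricPart (hJ : IsCanonicalSymmetry J)
    (hT : KreinDissipative J T) {p : T.graph} (hp : p ∈ symmetricPart J T) (q : T.graph) :
    graphForm J (p : H × H) (q : H × H) = 0 := by
  by_contra hz
  set z := graphForm J (p : H × H) (q : H × H) with hzdef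
  have hp0 : graphForm J (p : H × H) (p : H × H) = 0 := hp
  have hconj : graphForm J (q : H × H) (p : H × H) = (starRingEnd ℂ) z :=
    (conj_graphForm hJ _ _).symm
  -- Since `p` is neutral, the form at `q + t z p` is affine in `t` with slope `2 |z|²`; it cannot
  -- stay nonnegative unless `z = 0`.
  have key : ∀ t : ℝ, 0 ≤ (graphForm J (q : H × H) (q : H × H)).re + 2 * t * Complex.normSq z := by
    intro t
    have h := hT.re_graphForm_nonneg hJ (q + ((t : ℂ) * z) • p)
    have e : graphForm J ((q + ((t : ℂ) * z) • p : T.graph) : H × H)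
        ((q + ((t : ℂ) * z) • p : T.graph) : H × H) =
        graphForm J (q : H × H) (q : H × H) + ((2 * t * Complex.normSq z : ℝ) : ℂ) := by
      rw [Submodule.coe_add, Submodule.coe_smul]
      simp only [graphForm_add_left, graphForm_add_right, graphForm_smul_left,
        graphForm_smul_right, hp0, hconj, ← hzdef, map_mul, Complex.conj_ofReal]
      push_cast
      rw [Complex.normSq_eq_conj_mul_self]
      ring
    rw [e, Complex.add_re, Complex.ofReal_re] at h
    exact h
  have hpos : 0 < Complex.normSq z := Complex.normSq_pos.mpr hz
  have := key (-((graphForm J (q : H × H) (q : H × H)).re + 1) / (2 * Complex.normSq z))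
  have e : 2 * (-((graphForm J (q : H × H) (q : H × H)).re + 1) / (2 * Complex.normSq z)) *
      Complex.normSq z = -((graphForm J (q : H × H) (q : H × H)).re + 1) := by
    field_simp
  linarith

/-- The graph of the symmetric part of a dissipative operator, as a subspace of `H ⊕ H`. -/
def symmetricSubspace (J : H →L[ℂ] H) (hJ : IsCanonicalSymmetry J) (T : H →ₗ.[ℂ] H)
    (hT : KreinDissipative J T) : Submodule ℂ (H × H) where
  carrier := (fun p : T.graph => (p : H × H)) '' symmetricPart J T
  zero_mem' := ⟨0, by simp [symmetricPart, graphForm_zero_left], rfl⟩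
  add_mem' := by
    rintro _ _ ⟨p, hp, rfl⟩ ⟨q, hq, rfl⟩
    refine ⟨p + q, ?_, rfl⟩
    change graphForm J (p + q : H × H) _ = 0
    rw [graphForm_add_left, graphForm_eq_zero_of_mem_symmetricPart hJ hT hp,
      graphForm_eq_zero_of_mem_symmetricPart hJ hT hq, add_zero]
  smul_mem' := by
    rintro c _ ⟨p, hp, rfl⟩
    refine ⟨c • p, ?_, rfl⟩
    change graphForm J (c • p : H × H) _ = 0
    rw [graphForm_smul_left, graphForm_eq_zero_of_mem_symmetricPart hJ hT hp, mul_zero]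

theorem mem_symmetricSubspace_iff (hJ : IsCanonicalSymmetry J) (hT : KreinDissipative J T)
    {p : H × H} : p ∈ symmetricSubspace J hJ T hT ↔ p ∈ T.graph ∧ graphForm J p p = 0 := by
  constructor
  · rintro ⟨q, hq, rfl⟩
    exact ⟨q.2, hq⟩
  · rintro ⟨h1, h2⟩
    exact ⟨⟨p, h1⟩, h2, rfl⟩

theorem isClosed_symmetricSubspace (hJ : IsCanonicalSymmetry J) (hT : KreinDissipative J T)
    (hcl : T.IsClosed) : IsClosed (symmetricSubspace J hJ T hT : Set (H × H)) := by
  have : (symmetricSubspace J hJ T hT : Set (H × H)) =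
      (T.graph : Set (H × H)) ∩ {p | graphForm J p p = 0} := by
    ext p
    exact mem_symmetricSubspace_iff hJ hT
  rw [this]
  refine IsClosed.inter hcl (isClosed_eq ?_ continuous_const)
  unfold graphForm kreinForm
  fun_prop

end Dissipative

/-! ### The criterion for boundary maps. -/

section BoundaryMaps

variable {H H' : Type*} [NormedAddCommGroup H] [InnerProductSpace ℂ H]
  [NormedAddCommGroup H'] [InnerProductSpace ℂ H']
  {J : H →L[ℂ] H} {T : H →ₗ.[ℂ] H} {Γ₀ Γ₁ : T.graph →L[ℂ] H'}

theorem IsBoundaryMaps.graphForm_eq (h : IsBoundaryMaps J T Γ₀ Γ₁) (p q : T.graph) :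
    graphForm (1 : H' →L[ℂ] H') (Γ₀ p, Γ₁ p) (Γ₀ q, Γ₁ q) =
      graphForm J (p : H × H) (q : H × H) := by
  rw [graphForm_one, graphForm, h.green]

theorem IsBoundaryMaps.mem_ker_iff (h : IsBoundaryMaps J T Γ₀ Γ₁) (p : T.graph) :
    p ∈ LinearMap.ker ((Γ₀ : T.graph →ₗ[ℂ] H').prod (Γ₁ : T.graph →ₗ[ℂ] H')) ↔
      p ∈ symmetricPart J T := by
  constructor
  · intro hp
    have hp' : (Γ₀ p, Γ₁ p) = (0 : H' × H') := hp
    change graphForm J _ _ = 0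
    rw [← h.graphForm_eq, hp', graphForm_zero_left]
  · intro hp
    exact Prod.ext (h.vanish p hp).1 (h.vanish p hp).2

/-- Removing the component in the kernel, which is `S`, does not change the boundary values. -/
theorem IsBoundaryMaps.map_dissipativePart [CompleteSpace H] (hcl : T.IsClosed)
    (h : IsBoundaryMaps J T Γ₀ Γ₁) :
    (dissipativePart J T).map ((Γ₀ : T.graph →ₗ[ℂ] H').prod (Γ₁ : T.graph →ₗ[ℂ] H')) =
      LinearMap.range ((Γ₀ : T.graph →ₗ[ℂ] H').prod (Γ₁ : T.graph →ₗ[ℂ] H')) := by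
  refine le_antisymm LinearMap.map_le_range ?_
  rintro _ ⟨p, rfl⟩
  have hker : IsClosed (LinearMap.ker
      ((Γ₀ : T.graph →ₗ[ℂ] H').prod (Γ₁ : T.graph →ₗ[ℂ] H')) : Set T.graph) :=
    (Γ₀.prod Γ₁).isClosed_ker
  obtain ⟨m, hm, hn⟩ := exists_mem_graphOrthogonal hcl _ hker p
  refine ⟨p - m, fun q hq => hn q ((h.mem_ker_iff q).mpr hq), ?_⟩
  rw [map_sub, LinearMap.mem_ker.mp hm, sub_zero]

/-- Split the graph of `T` into `S₁` and `N₁`: only `N₁` contributes to `Γ₁`, and `S₁` contributes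
`Γ₀(S₁)` to the first component. -/
theorem mem_range_prod_iff [CompleteSpace H] (hcl : T.IsClosed) (u : H' × H') :
    u ∈ LinearMap.range ((Γ₀ : T.graph →ₗ[ℂ] H').prod (Γ₁ : T.graph →ₗ[ℂ] H')) ↔
      ∃ y, (u.2, y) ∈ theta01 T Γ₀ Γ₁ ∧ ∃ m ∈ imageKer T Γ₀ Γ₁, u.1 = y + m := by
  constructor
  · rintro ⟨p, rfl⟩
    obtain ⟨m, hm, hn⟩ := exists_mem_graphOrthogonal hcl (kerPart T Γ₁) Γ₁.isClosed_ker p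
    have hm0 : Γ₁ m = 0 := hm
    refine ⟨Γ₀ (p - m), ⟨p - m, hn, ?_⟩, Γ₀ m, ⟨m, hm, rfl⟩, ?_⟩
    · simp [hm0]
    · simp
  · rintro ⟨y, ⟨n, -, hn⟩, _, ⟨m, hm, rfl⟩, hu⟩
    have hm0 : Γ₁ m = 0 := hm
    simp only [LinearMap.prod_apply, Prod.mk.injEq, Function.prod_apply] at hn
    refine ⟨n + m, Prod.ext ?_ ?_⟩
    · simp [hu, ← hn.2]
    · simp [← hn.1, hm0]

theorem IsBoundaryMaps.tfae [CompleteSpace H] [CompleteSpace H']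
    (hJ : IsCanonicalSymmetry J) (hcl : T.IsClosed)
    (hT : KreinDissipative J T) (h : IsBoundaryMaps J T Γ₀ Γ₁) :
    List.TFAE [
        FormComplete (graphForm (1 : H' →L[ℂ] H'))
          (LinearMap.range ((Γ₀ : T.graph →ₗ[ℂ] H').prod (Γ₁ : T.graph →ₗ[ℂ] H'))),
        FormComplete (fun p q : T.graph => graphForm J (p : H × H) (q : H × H))
          (dissipativePart J T),
        relNorm (restrictQuotient
          ((Γ₁ - Complex.I • Γ₀ : T.graph →L[ℂ] H') : T.graph →ₗ[ℂ] H')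
          ((Γ₁ + Complex.I • Γ₀ : T.graph →L[ℂ] H') : T.graph →ₗ[ℂ] H')
          (dissipativePart J T)) < 1,
        LinearMap.range (Γ₁ : T.graph →ₗ[ℂ] H') ⊔
            (relDomain (theta01 T Γ₀ Γ₁).adjoint ⊓ (imageKer T Γ₀ Γ₁)ᗮ) = ⊤ ∧
          relImage (relSub (theta01 T Γ₀ Γ₁).adjoint (theta01 T Γ₀ Γ₁)) (imageKer T Γ₀ Γ₁)ᗮ ⊔
            imageKer T Γ₀ Γ₁ = ⊤] := by
  set R := LinearMap.range ((Γ₀ : T.graph →ₗ[ℂ] H').prod (Γ₁ : T.graph →ₗ[ℂ] H')) with hRdef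
  have hmap := h.map_dissipativePart hcl
  rw [← hRdef] at hmap
  have hR : IsClosed (R : Set (H' × H')) := h.closedRange
  have hpos : ∀ u ∈ R, 0 ≤ (graphForm (1 : H' →L[ℂ] H') u u).re := by
    rintro _ ⟨p, rfl⟩
    exact (hT.re_graphForm_nonneg hJ p).trans_eq (congrArg Complex.re (h.graphForm_eq p p).symm)
  have hdef : ∀ u ∈ R, graphForm (1 : H' →L[ℂ] H') u u = 0 → u = 0 := by
    rintro _ ⟨p, rfl⟩ hp
    exact (h.mem_ker_iff p).mpr ((h.graphForm_eq p p).symm.trans hp)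
  have key := tfae_formComplete_graphForm isCanonicalSymmetry_one R hR hpos hdef
  tfae_have 1 ↔ 2 := formComplete_map_iff _ hmap fun p _ => h.graphForm_eq p p
  tfae_have 1 ↔ 3 := by
    refine (key.out 0 1).trans (relNorm_lt_one_iff R _ (fun p => ?_) hpos).symm
    rw [← hmap]
    constructor
    · rintro ⟨n, hn, rfl⟩
      exact ⟨_, ⟨n, hn, rfl⟩, rfl⟩
    · rintro ⟨_, ⟨n, hn, rfl⟩, rfl⟩
      exact ⟨n, hn, rfl⟩
  tfae_have 1 ↔ 4 := by
    refine (key.out 0 2).trans ((forall_exists_graphForm_eq_zero_iff R _ _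
      (mem_range_prod_iff hcl)).trans ?_)
    rw [hRdef, ← LinearMap.range_comp, LinearMap.snd_prod]
  tfae_finish

end BoundaryMaps

/-! ### Unitary boundary pairs and their operator parts. -/

section UnitaryRelation

variable {H H' : Type*} [NormedAddCommGroup H] [InnerProductSpace ℂ H]
  [NormedAddCommGroup H'] [InnerProductSpace ℂ H']
  {J : H →L[ℂ] H} {Γ : Submodule ℂ ((H × H) × (H' × H'))}

/-- Unitarity describes `Γ` as the solution set of a family of continuous equations. -/
theorem IsUnitaryRelation.isClosed (h : IsUnitaryRelation J Γ) :
    IsClosed (Γ : Set ((H × H) × (H' × H'))) := by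
  have : (Γ : Set ((H × H) × (H' × H'))) =
      ⋂ z ∈ Γ, {w | graphForm J w.1 z.1 = graphForm 1 w.2 z.2} := by
    ext w
    simp only [SetLike.mem_coe, Set.mem_iInter, Set.mem_ofPred_eq]
    exact (h w.1 w.2).trans ⟨fun h z hz => h z.1 z.2 hz, fun h q v hz => h (q, v) hz⟩
  rw [this]
  refine isClosed_biInter fun z _ => isClosed_eq ?_ ?_
  · exact (continuous_graphForm_left z.1).comp continuous_fst
  · exact (continuous_graphForm_left z.2).comp continuous_snd

/-- Every bounded functional on a subspace of `H ⊕ H` is represented by the indefinite metric. -/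
theorem exists_graphForm_eq [CompleteSpace H] (hJ : IsCanonicalSymmetry J) (D : Submodule ℂ (H × H))
    (l : D →L[ℂ] ℂ) : ∃ p, ∀ q : D, graphForm J p (q : H × H) = l q := by
  -- Extend by Hahn–Banach, represent by Riesz, and apply the Gram involution.
  obtain ⟨g, hg, -⟩ := exists_extension_norm_eq D l
  let e := WithLp.prodContinuousLinearEquiv 2 ℂ H H
  let k := (InnerProductSpace.toDual ℂ (WithLp 2 (H × H))).symm
    (g ∘L (e : WithLp 2 (H × H) →L[ℂ] H × H))
  refine ⟨WithLp.ofLp (graphOp J k), fun q => ?_⟩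
  rw [graphForm_eq_inner, WithLp.toLp_ofLp, ← graphOp_inner_left hJ, graphOp_graphOp hJ,
    InnerProductSpace.toDual_symm_apply, ← hg]
  rfl

/-- The multivalued part of a linear relation. -/
def multivaluedPart {E F : Type*} [AddCommGroup E] [Module ℂ E] [AddCommGroup F] [Module ℂ F]
    (R : Submodule ℂ (E × F)) : Submodule ℂ F :=
  R.comap (LinearMap.inr ℂ E F)

theorem mem_multivaluedPart {E F : Type*} [AddCommGroup E] [Module ℂ E] [AddCommGroup F]
    [Module ℂ F] {R : Submodule ℂ (E × F)} {w : F} : w ∈ multivaluedPart R ↔ (0, w) ∈ R :=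
  Iff.rfl

/-- The operator part of a linear relation, as a subspace. -/
noncomputable def operatorSubspace (Γ : Submodule ℂ ((H × H) × (H' × H'))) :
    Submodule ℂ ((H × H) × (H' × H')) where
  carrier := operatorPart Γ
  zero_mem' := ⟨Γ.zero_mem, fun w _ => by simp [graphInner]⟩
  add_mem' := by
    rintro a b ⟨ha, ha'⟩ ⟨hb, hb'⟩
    refine ⟨Γ.add_mem ha hb, fun w hw => ?_⟩
    have h1 := ha' w hw
    have h2 := hb' w hw
    rw [graphInner_eq_inner] at h1 h2 ⊢
    rw [Prod.snd_add, WithLp.toLp_add, inner_add_right, h1, h2, add_zero]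
  smul_mem' := by
    rintro c a ⟨ha, ha'⟩
    refine ⟨Γ.smul_mem c ha, fun w hw => ?_⟩
    have h1 := ha' w hw
    rw [graphInner_eq_inner] at h1 ⊢
    rw [Prod.smul_snd, WithLp.toLp_smul, inner_smul_right, h1, mul_zero]

theorem isClosed_operatorSubspace (hΓ : IsClosed (Γ : Set ((H × H) × (H' × H')))) :
    IsClosed (operatorSubspace Γ : Set ((H × H) × (H' × H'))) := by
  have : (operatorSubspace Γ : Set ((H × H) × (H' × H'))) =
      (Γ : Set ((H × H) × (H' × H'))) ∩ ⋂ w ∈ multivaluedPart Γ, {z | graphInner w z.2 = 0} := by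
    ext z
    simp only [Set.mem_inter_iff, Set.mem_iInter, Set.mem_ofPred_eq, mem_multivaluedPart]
    rfl
  rw [this]
  refine hΓ.inter (isClosed_biInter fun w _ => isClosed_eq ?_ continuous_const)
  exact (continuous_graphInner_right w).comp continuous_snd

theorem operatorSubspace_snd_eq_zero {u : H' × H'} (hu : ((0 : H × H), u) ∈ operatorSubspace Γ) :
    u = 0 := by
  have h := hu.2 u hu.1
  rw [graphInner_eq_inner, inner_self_eq_zero] at h
  exact (WithLp.toLp_eq_zero 2).mp h

theorem exists_mem_operatorSubspace [CompleteSpace H']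
    (hΓ : IsClosed (Γ : Set ((H × H) × (H' × H'))))
    {p : H × H} {u : H' × H'} (hu : (p, u) ∈ Γ) :
    ∃ m ∈ multivaluedPart Γ, (p, u - m) ∈ operatorSubspace Γ := by
  have hcl : IsClosed (multivaluedPart Γ : Set (H' × H')) :=
    hΓ.preimage (continuous_const.prodMk continuous_id)
  obtain ⟨m, hm, horth⟩ := exists_sub_graphInner_eq_zero _ hcl u
  refine ⟨m, hm, ?_, horth⟩
  simpa using Γ.sub_mem hu hm

/-- The operator part of a closed linear relation with closed domain is a bounded operator. -/
theorem exists_operatorPart_clm [CompleteSpace H] [CompleteSpace H']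
    (hΓ : IsClosed (Γ : Set ((H × H) × (H' × H'))))
    (hD : IsClosed (relDomain Γ : Set (H × H))) :
    ∃ φ : relDomain Γ →L[ℂ] H' × H', ∀ p : relDomain Γ, ((p : H × H), φ p) ∈ operatorPart Γ := by
  have : CompleteSpace (operatorSubspace Γ) := (isClosed_operatorSubspace hΓ).completeSpace_coe
  have : CompleteSpace (relDomain Γ) := hD.completeSpace_coe
  -- The projection to the domain is a continuous bijection of Banach spaces; its inverse is bounded
  -- by the open mapping theorem.
  let π : operatorSubspace Γ →L[ℂ] relDomain Γ :=
    (ContinuousLinearMap.fst ℂ (H × H) (H' × H') ∘L (operatorSubspace Γ).subtypeL).codRestrict _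
      fun z => ⟨z, z.2.1, rfl⟩
  have hinj : π.ker = ⊥ := by
    refine LinearMap.ker_eq_bot'.mpr fun z hz => ?_
    obtain ⟨⟨p, u⟩, hpu⟩ := z
    have hp : p = 0 := congrArg Subtype.val hz
    subst hp
    exact Subtype.ext (Prod.ext rfl (operatorSubspace_snd_eq_zero hpu))
  have hsurj : π.range = ⊤ := by
    refine LinearMap.range_eq_top.mpr ?_
    rintro ⟨_, ⟨⟨p, u⟩, hpu, rfl⟩⟩
    obtain ⟨m, -, hm⟩ := exists_mem_operatorSubspace hΓ hpu
    exact ⟨⟨_, hm⟩, rfl⟩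
  let e := ContinuousLinearEquiv.ofBijective π hinj hsurj
  refine ⟨ContinuousLinearMap.snd ℂ (H × H) (H' × H') ∘L (operatorSubspace Γ).subtypeL ∘L
    (e.symm : relDomain Γ →L[ℂ] operatorSubspace Γ), fun p => ?_⟩
  have h1 : ((e.symm p : operatorSubspace Γ) : (H × H) × (H' × H')).1 = p :=
    congrArg Subtype.val (ContinuousLinearEquiv.ofBijective_apply_symm_apply π hinj hsurj p)
  have h2 := (e.symm p).2
  rw [← h1]
  exact h2

/-- A unitary relation with closed domain has closed range: the range is the orthogonal companion
of the multivalued part. -/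
theorem IsUnitaryRelation.exists_mem_iff [CompleteSpace H] [CompleteSpace H']
    (hJ : IsCanonicalSymmetry J) (h : IsUnitaryRelation J Γ)
    (hD : IsClosed (relDomain Γ : Set (H × H))) (u : H' × H') :
    (∃ p, (p, u) ∈ Γ) ↔ ∀ w ∈ multivaluedPart Γ, graphForm 1 u w = 0 := by
  constructor
  · rintro ⟨p, hp⟩ w hw
    rw [← (h p u).mp hp 0 w hw, graphForm_eq_zero_comm hJ, graphForm_zero_left]
  · intro hu
    obtain ⟨φ, hφ⟩ := exists_operatorPart_clm h.isClosed hD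
    -- A preimage `p` of `u` must represent this functional. Orthogonality of `u` to the multivalued
    -- part makes its value independent of the chosen element of `Γ` over `q`.
    let l : relDomain Γ →L[ℂ] ℂ :=
      { toFun := fun q => graphForm 1 u (φ q)
        map_add' := fun q q' => by rw [map_add, graphForm_add_right]
        map_smul' := fun c q => by rw [map_smul, graphForm_smul_right]; rfl
        cont := (continuous_graphForm_right u).comp φ.continuous }
    obtain ⟨p, hp⟩ := exists_graphForm_eq hJ _ l
    refine ⟨p, (h p u).mpr fun q v hqv => ?_⟩
    let q' : relDomain Γ := ⟨q, _, hqv, rfl⟩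
    have hw : v - φ q' ∈ multivaluedPart Γ := by
      rw [mem_multivaluedPart]
      simpa [q'] using Γ.sub_mem hqv (hφ q').1
    have h1 := hu _ hw
    rw [graphForm_sub_right, sub_eq_zero] at h1
    rw [h1]
    exact hp q'

theorem IsUnitaryBoundaryPair.exists_isBoundaryMaps [CompleteSpace H] [CompleteSpace H']
    {T : H →ₗ.[ℂ] H} (hJ : IsCanonicalSymmetry J)
    (hcl : T.IsClosed) (hT : KreinDissipative J T) (hΓ : IsUnitaryBoundaryPair J T Γ) :
    ∃ Γ₀ Γ₁ : T.graph →L[ℂ] H',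
      (∀ p : T.graph, ((p : H × H), (Γ₀ p, Γ₁ p)) ∈ operatorPart Γ) ∧
      IsBoundaryMaps J T Γ₀ Γ₁ := by
  obtain ⟨hU, hdom⟩ := hΓ
  have hD : IsClosed (relDomain Γ : Set (H × H)) := by
    have : (relDomain Γ : Set (H × H)) =
        ⋂ q ∈ symmetricPart J T, {p | graphForm J p (q : H × H) = 0} := by
      ext p
      simp only [SetLike.mem_coe, Set.mem_iInter, Set.mem_ofPred_eq]
      exact hdom p
    rw [this]
    exact isClosed_biInter fun q _ => isClosed_eq (continuous_graphForm_left _) continuous_const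
  have hTD : T.graph ≤ relDomain Γ := fun p hp => (hdom p).mpr fun q hq =>
    (graphForm_eq_zero_comm hJ).mp (graphForm_eq_zero_of_mem_symmetricPart hJ hT hq ⟨p, hp⟩)
  obtain ⟨φ, hφ⟩ := exists_operatorPart_clm hU.isClosed hD
  have huniq : ∀ (p : relDomain Γ) u, ((p : H × H), u) ∈ operatorSubspace Γ → φ p = u := by
    intro p u hu
    have := (operatorSubspace Γ).sub_mem (hφ p) hu
    refine sub_eq_zero.mp (operatorSubspace_snd_eq_zero (Γ := Γ) ?_)
    simpa using this
  -- A vector with `φ p = 0` is orthogonal to the whole domain `S^c`, so it lies in `S^cc`, which is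
  -- `S` because `S` is closed.
  have hker : ∀ p : relDomain Γ, φ p = 0 → (p : H × H) ∈ T.graph := by
    intro p hp
    refine ((mem_symmetricSubspace_iff hJ hT).mp (mem_of_forall_graphForm_eq_zero hJ _
      (isClosed_symmetricSubspace hJ hT hcl) p fun q hq => ?_)).1
    obtain ⟨⟨q, v⟩, hqv, rfl⟩ := (hdom q).mpr fun s hs =>
      (graphForm_eq_zero_comm hJ).mp (hq s ⟨s, hs, rfl⟩)
    have h1 := hφ p
    rw [hp] at h1
    have h2 := (hU _ _).mp h1.1 q v hqv
    rwa [graphForm_zero_left] at h2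
  let ψ : T.graph →L[ℂ] H' × H' := φ ∘L
    (T.graph.subtypeL.codRestrict (relDomain Γ) fun p => hTD p.2)
  have hψ : ∀ p : T.graph, ((p : H × H), ψ p) ∈ operatorPart Γ := fun p => hφ ⟨p, hTD p.2⟩
  refine ⟨ContinuousLinearMap.fst ℂ H' H' ∘L ψ, ContinuousLinearMap.snd ℂ H' H' ∘L ψ, hψ,
    ?_, ?_, ?_⟩
  · intro p q
    have h1 := (hU _ _).mp (hψ p).1 _ _ (hψ q).1
    rw [graphForm_one, graphForm] at h1
    exact mul_left_cancel₀ (neg_ne_zero.mpr Complex.I_ne_zero) h1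
  · intro p hp
    -- For `p` in `S` the pair `(p, 0)` belongs to `Γ` by unitarity, since the domain of `Γ` is
    -- orthogonal to `S`.
    have h0 : ψ p = 0 := by
      refine huniq ⟨p, hTD p.2⟩ 0 ⟨(hU _ _).mpr fun q v hqv => ?_, fun w _ => ?_⟩
      · rw [graphForm_zero_left]
        exact (graphForm_eq_zero_comm hJ).mp ((hdom q).mp ⟨_, hqv, rfl⟩ p hp)
      · simp [graphInner]
    exact ⟨congrArg Prod.fst h0, congrArg Prod.snd h0⟩
  · change IsClosed (Set.range ψ)
    have hrange : IsClosed (φ.range : Set (H' × H')) := by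
      -- The range of the operator part consists of the range of `Γ`, the companion of the
      -- multivalued part, cut down to the Hilbert orthogonal complement of that part.
      have : (φ.range : Set (H' × H')) = ⋂ w ∈ multivaluedPart Γ,
          {u | graphForm (1 : H' →L[ℂ] H') u w = 0} ∩ {u | graphInner w u = 0} := by
        ext u
        simp only [Set.mem_iInter, Set.mem_inter_iff, Set.mem_ofPred_eq]
        constructor
        · rintro ⟨p, rfl⟩ w hw
          exact ⟨(hU.exists_mem_iff hJ hD _).mp ⟨_, (hφ p).1⟩ w hw, (hφ p).2 w hw⟩
        · intro hu
          obtain ⟨p, hp⟩ := (hU.exists_mem_iff hJ hD u).mpr fun w hw => (hu w hw).1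
          exact ⟨⟨p, _, hp, rfl⟩, huniq _ u ⟨hp, fun w hw => (hu w hw).2⟩⟩
      rw [this]
      exact isClosed_biInter fun w _ =>
        (isClosed_eq (continuous_graphForm_left w) continuous_const).inter
          (isClosed_eq (continuous_graphInner_right w) continuous_const)
    have : CompleteSpace (relDomain Γ) := hD.completeSpace_coe
    have : CompleteSpace φ.range := hrange.completeSpace_coe
    let φ' : relDomain Γ →L[ℂ] φ.range := φ.codRestrict _ fun p => ⟨p, rfl⟩
    have hsurj : Function.Surjective φ' := by
      rintro ⟨_, ⟨p, rfl⟩⟩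
      exact ⟨p, rfl⟩
    let A : Set φ.range := {u | (u : H' × H') ∈ Set.range ψ}
    -- `φ'` is a surjection of Banach spaces, hence a quotient map. As `T` contains the kernel, the
    -- preimage of `A` is the closed graph of `T`.
    have hA : IsClosed A := by
      rw [← (φ'.isQuotientMap hsurj).isClosed_preimage]
      have : φ' ⁻¹' A = Subtype.val ⁻¹' (T.graph : Set (H × H)) := by
        ext p
        constructor
        · rintro ⟨q, hq⟩
          have h0 : φ (p - ⟨q, hTD q.2⟩) = 0 := by
            rw [map_sub, sub_eq_zero]
            exact hq.symm
          simpa using T.graph.add_mem (hker _ h0) q.2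
        · exact fun hp => ⟨⟨p, hp⟩, rfl⟩
      rw [this]
      exact IsClosed.preimage continuous_subtype_val hcl
    have hAψ : Set.range ψ = Subtype.val '' A := by
      ext u
      constructor
      · rintro ⟨p, rfl⟩
        exact ⟨⟨ψ p, ⟨p, hTD p.2⟩, rfl⟩, ⟨p, rfl⟩, rfl⟩
      · rintro ⟨v, hv, rfl⟩
        exact hv
    rw [hAψ]
    exact hrange.isClosedEmbedding_subtypeVal.isClosedMap _ hA

end UnitaryRelation

theorem mainTheorem2 {H H' : Type*}
    [NormedAddCommGroup H] [InnerProductSpace ℂ H] [CompleteSpace H]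
    [NormedAddCommGroup H'] [InnerProductSpace ℂ H'] [CompleteSpace H']
    (J : H →L[ℂ] H) (hJ : IsCanonicalSymmetry J)
    (T : H →ₗ.[ℂ] H) (hclosed : T.IsClosed) (hdiss : KreinDissipative J T) :
    (∀ Γ₀ Γ₁ : T.graph →L[ℂ] H', IsBoundaryMaps J T Γ₀ Γ₁ →
      List.TFAE [
        FormComplete (graphForm (1 : H' →L[ℂ] H'))
          (LinearMap.range ((Γ₀ : T.graph →ₗ[ℂ] H').prod (Γ₁ : T.graph →ₗ[ℂ] H'))),
        FormComplete (fun p q : T.graph => graphForm J (p : H × H) (q : H × H))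
          (dissipativePart J T),
        relNorm (restrictQuotient
          ((Γ₁ - Complex.I • Γ₀ : T.graph →L[ℂ] H') : T.graph →ₗ[ℂ] H')
          ((Γ₁ + Complex.I • Γ₀ : T.graph →L[ℂ] H') : T.graph →ₗ[ℂ] H')
          (dissipativePart J T)) < 1,
        LinearMap.range (Γ₁ : T.graph →ₗ[ℂ] H') ⊔
            (relDomain (theta01 T Γ₀ Γ₁).adjoint ⊓ (imageKer T Γ₀ Γ₁)ᗮ) = ⊤ ∧
          relImage (relSub (theta01 T Γ₀ Γ₁).adjoint (theta01 T Γ₀ Γ₁)) (imageKer T Γ₀ Γ₁)ᗮ ⊔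
            imageKer T Γ₀ Γ₁ = ⊤]) ∧
    (∀ Γ : Submodule ℂ ((H × H) × (H' × H')), IsUnitaryBoundaryPair J T Γ →
      ∃ Γ₀ Γ₁ : T.graph →L[ℂ] H',
        (∀ p : T.graph, ((p : H × H), (Γ₀ p, Γ₁ p)) ∈ operatorPart Γ) ∧
        IsBoundaryMaps J T Γ₀ Γ₁) :=
  ⟨fun _ _ h => h.tfae hJ hclosed hdiss, fun _ h => h.exists_isBoundaryMaps hJ hclosed hdiss⟩
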